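/- **Setting.** Let $\mathcal M$ be a smooth finite-dimensional manifold (without boundary) with a smooth Riemannian metric, let $g:\mathcal M\to\mathbb R$ be twice continuously differentiable with Riemannian gradient $\nabla g$, and let $\mathrm R:\mathrm T\mathcal M\to\mathcal M$ be a retraction, i.e. a smooth map such that for all $y\in\mathcal M$ and $u\in \mathrm T_y\mathcal M$ the curve $c(t)=\mathrm R_y(tu)$ satisfies $c(0)=y$, $c'(0)=u$. Let $\Phi:\mathcal M\to\mathcal M$ be a map (the hook) with $g(\Phi(y))\le g(y)$ for all $y\in\mathcal M$. For $y\in\mathcal M$ let $\hat g_y=g\circ \mathrm R_y:\mathrm T_y\mathcal M\to\mathbb R$, let $\nabla\hat g_y(0)$ and $\nabla^2\hat g_y(0)$ be its gradient and Hessian at $0$, and let $m_y(s)=g(y)+\langle s,\nabla\hat g_y(0)\rangle+\tfrac12\langle s,\nabla^2\hat g_y(0)[s]\rangle$. Let $\lambda(y)$ be the left-most eigenvalue of $\nabla^2\hat g_y(0)$ and $\lambda(y)_-=\min(\lambda(y),0)$ (which is $0$ if $\dim\mathcal M=0$). **Algorithm.** Fix parameters $\gamma_c,\eta\in(0,1)$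 and $0<\underline\gamma\le\overline\gamma<\infty$, an input point in $\mathcal M$, and $\gamma_0\in[\underline\gamma,\overline\gamma]$. Let $y_0$ be the image of the input point under $\Phi$. For $k=0,1,2,\dots$, write $\hat g_k=\hat g_{y_k}$, $m_k=m_{y_k}$, $\lambda_k=\lambda(y_k)$, and: 1. If $\lambda_k<0$ and $\|\nabla g(y_k)\|^2<|(\lambda_k)_-|^3$, set $\delta_k=\gamma_k|(\lambda_k)_-|$ and let $u_k$ be a unit-norm eigenvector of $\nabla^2\hat g_k(0)$ for the eigenvalue $\lambda_k$ with $\langle u_k,\nabla g(y_k)\rangle\le 0$. Otherwise set $\delta_k=\gamma_k\|\nabla g(y_k)\|$ and $u_k=-\nabla g(y_k)$. 2. Let $s_k^c=t_ku_k$, where $t_k$ minimizes $m_k(tu_k)$ over $t\ge0$ with $\|tu_k\|\le\delta_k$. Choose any $s_k\in \mathrm T_{y_k}\mathcal M$ with $\|s_k\|\le\delta_k$ and $m_k(s_k)\le m_k(s_k^c)$. 3. Let $\rho_k=\dfrac{g(y_k)-g(\mathrm R_{y_k}(s_k))}{m_k(0)-m_k(s_k)}$, or $\rho_k=1$ if the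 denominator is zero. 4. If $\rho_k\ge\eta$, set $y_{k+1}=\Phi(\mathrm R_{y_k}(s_k))$ and choose any $\gamma_{k+1}\in[\underline\gamma,\overline\gamma]$; otherwise set $y_{k+1}=y_k$ and $\gamma_{k+1}=\gamma_c\gamma_k$. **Theorem.** Let $(y_k)_{k\ge0}$ be generated by this algorithm with steps $(s_k)$. Suppose that $L_1,L_2\ge0$ are such that for all $k$ one has $\|\nabla^2\hat g_k(0)\|\le L_1$ (operator norm), $$\bigl|g(\mathrm R_{y_k}(s_k))-g(y_k)-\langle s_k,\nabla g(y_k)\rangle\bigr|\le\tfrac{L_1}{2}\|s_k\|^2,$$ $$\bigl|g(\mathrm R_{y_k}(s_k))-g(y_k)-\langle s_k,\nabla g(y_k)\rangle-\tfrac12\langle s_k,\nabla^2\hat g_k(0)[s_k]\rangle\bigr|\le\tfrac{L_2}{6}\|s_k\|^3,$$ and that $g_{\min}\in\mathbb R$ satisfies $g(y_k)\ge g_{\min}$ for all $k$. Define $$\gamma_{\min}=\min\Bigl(\underline\gamma,\ \frac{\gamma_c}{1+L_1},\ \frac{\gamma_c(1-\eta)}{2L_1},\ \frac{3\gamma_c(1-\eta)}{L_2}\Bigr),\qquad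 \kappa_{\min}=\tfrac12\,\eta\,\gamma_{\min}^2,$$ where a fraction with zero denominator is read as $+\infty$. Then: (a) $\gamma_{\min}\in(0,1)$. (b) For all $\epsilon_1,\epsilon_2>0$, the set $\{k\in\mathbb N:\ \|\nabla g(y_k)\|>\epsilon_1\ \text{or}\ |(\lambda_k)_-|>\epsilon_2\}$ is finite and its cardinality $K(\epsilon_1,\epsilon_2)$ satisfies $$K(\epsilon_1,\epsilon_2)\le\Bigl\lceil\log_{\gamma_c}\!\Bigl(\frac{\gamma_{\min}}{\overline\gamma}\Bigr)+1\Bigr\rceil\Bigl\lfloor\frac{g(y_0)-g_{\min}}{\kappa_{\min}}\max\Bigl(\frac1{\epsilon_1^2},\frac1{\epsilon_2^3}\Bigr)\Bigr\rfloor.$$ (c) Every accumulation point $y$ of $(y_k)_{k\ge0}$ (if any) is second-order critical for $g$: for every smooth curve $c:\mathbb R\to\mathcal M$ with $c(0)=y$ one has $(g\circ c)'(0)=0$ and $(g\circ c)''(0)\ge0$. -/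

import Mathlib

open Set Filter Topology Bundle Manifold
open scoped ContDiff ENNReal Gradient InnerProductSpace

noncomputable section

section Euclidean

/-- The left-most eigenvalue of a linear map on a real inner product space
(with value `0` in dimension zero, where there is no eigenvalue). -/
def leftmostEigenvalue {V : Type*} [NormedAddCommGroup V] [InnerProductSpace ℝ V]
    (A : V →L[ℝ] V) : ℝ :=
  sInf {μ : ℝ | Module.End.HasEigenvalue (A : Module.End ℝ V) μ}

variable {V : Type*} [NormedAddCommGroup V] [InnerProductSpace ℝ V] [CompleteSpace V]

/-- The Hessian of `f` at `x`: the derivative at `x` of the gradient vector field of `f`. -/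
def hessianAt (f : V → ℝ) (x : V) : V →L[ℝ] V :=
  fderiv ℝ (fun z => ∇ f z) x

/-- The second-order Taylor model of `f` at the origin. -/
def quadModel (f : V → ℝ) (s : V) : ℝ :=
  f 0 + ⟪s, ∇ f 0⟫_ℝ + (1 / 2) * ⟪s, hessianAt f 0 s⟫_ℝ

end Euclidean

section Riemannian

variable {E : Type*} [NormedAddCommGroup E] [NormedSpace ℝ E] [FiniteDimensional ℝ E]
  {H : Type*} [TopologicalSpace H] {I : ModelWithCorners ℝ E H}
  {M : Type*} [TopologicalSpace M] [ChartedSpace H M]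
  [RiemannianBundle (fun x : M => TangentSpace I x)]

/-- Tangent spaces are finite-dimensional inner product spaces, hence complete. -/
instance instCompleteSpaceTangentSpace (y : M) : CompleteSpace (TangentSpace I y) :=
  haveI : FiniteDimensional ℝ (TangentSpace I y) := inferInstanceAs (FiniteDimensional ℝ E)
  FiniteDimensional.complete ℝ (TangentSpace I y)

/-- The Riemannian gradient of `g` at `y`: the Riesz representative of the differential. -/
def riemannianGradient (I : ModelWithCorners ℝ E H)
    [RiemannianBundle (fun x : M => TangentSpace I x)] (g : M → ℝ) (y : M) : TangentSpace I y :=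
  (InnerProductSpace.toDual ℝ (TangentSpace I y)).symm (mvfderiv I g y)

/-- A retraction: a smooth map `R` from the tangent bundle to the manifold such that, for every
tangent vector `u` at `y`, the curve `t ↦ R_y (t u)` passes through `y` at time `0` with
velocity `u`. -/
structure IsRetraction (I : ModelWithCorners ℝ E H) [IsManifold I ∞ M]
    (R : TangentBundle I M → M) : Prop where
  smooth : ContMDiff I.tangent I ∞ R
  map_zero : ∀ y : M, R ⟨y, 0⟩ = y
  velocity : ∀ (y : M) (u : TangentSpace I y),
    (mfderiv 𝓘(ℝ, ℝ) I (fun t : ℝ => R ⟨y, t • u⟩) 0 (1 : ℝ) : E) = u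

/-- `y` is second-order stationary (2-critical) for `g`: along every smooth curve `c` passing
through `y` at time `0`, one has `(g ∘ c)'(0) = 0` and `(g ∘ c)''(0) ≥ 0`. -/
def IsTwoCritical (I : ModelWithCorners ℝ E H) (g : M → ℝ) (y : M) : Prop :=
  ∀ c : ℝ → M, ContMDiff 𝓘(ℝ, ℝ) I ∞ c → c 0 = y →
    deriv (g ∘ c) 0 = 0 ∧ 0 ≤ deriv (deriv (g ∘ c)) 0

section Algorithm

variable (g : M → ℝ) (R : TangentBundle I M → M)

/-- The pullback `g ∘ R_y`, a function on the tangent space at `y`. -/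
def pullback (y : M) (s : TangentSpace I y) : ℝ := g (R ⟨y, s⟩)

/-- The Hessian at the origin of the pullback at `y`. -/
def pullbackHessian (y : M) : TangentSpace I y →L[ℝ] TangentSpace I y :=
  hessianAt (pullback g R y) 0

/-- The left-most eigenvalue of the Hessian at the origin of the pullback at `y`. -/
def lam (y : M) : ℝ := leftmostEigenvalue (pullbackHessian g R y)

/-- The negative part `min(λ, 0)` of the left-most eigenvalue. -/
def lamNeg (y : M) : ℝ := min (lam g R y) 0

/-- The test deciding that the radius is set from the left-most eigenvalue (and not from the
gradient). -/
def UsesCurvature (y : M) : Prop :=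
  lam g R y < 0 ∧ ‖riemannianGradient I g y‖ ^ 2 < |lamNeg g R y| ^ 3

open Classical in
/-- The trust-region radius at `y`, given the current value `γ` of the radius parameter. -/
def radius (y : M) (γ : ℝ) : ℝ :=
  if UsesCurvature g R y then γ * |lamNeg g R y| else γ * ‖riemannianGradient I g y‖

/-- `u` is an admissible direction for the Cauchy step at `y`: a unit eigenvector for the left-most
eigenvalue, not an ascent direction, if the radius is set from the left-most eigenvalue, and
the negative gradient otherwise. -/
def IsCauchyDirection (y : M) (u : TangentSpace I y) : Prop :=
  (UsesCurvature g R y → ‖u‖ = 1 ∧ pullbackHessian g R y u = lam g R y • u ∧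
    ⟪u, riemannianGradient I g y⟫_ℝ ≤ 0) ∧
  (¬ UsesCurvature g R y → u = -riemannianGradient I g y)

/-- `sc` is a Cauchy step at `y`: a minimizer of the model along a Cauchy direction, within the
trust region. -/
def IsCauchyStep (y : M) (γ : ℝ) (sc : TangentSpace I y) : Prop :=
  ∃ (u : TangentSpace I y) (t : ℝ), IsCauchyDirection g R y u ∧
    t ∈ {τ : ℝ | 0 ≤ τ ∧ ‖τ • u‖ ≤ radius g R y γ} ∧
    IsMinOn (fun τ : ℝ => quadModel (pullback g R y) (τ • u))
      {τ : ℝ | 0 ≤ τ ∧ ‖τ • u‖ ≤ radius g R y γ} t ∧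
    sc = t • u

open Classical in
/-- The ratio of actual to model decrease for the step `s` at `y`, set to `1` if the model
decrease is zero. -/
def decreaseRatio (y : M) (s : TangentSpace I y) : ℝ :=
  if quadModel (pullback g R y) 0 - quadModel (pullback g R y) s = 0 then 1
  else (g y - g (R ⟨y, s⟩)) /
    (quadModel (pullback g R y) 0 - quadModel (pullback g R y) s)

/-- The sequences `y` (iterates), `γ` (radius parameters) and `s` (trial steps) are generated by
the hooked Riemannian trust-region method with hook `Φ`, parameters `γc`, `η`, `γlo ≤ γhi`, and
input point `yin`. -/
structure IsHookedTrustRegionRun (Φ : M → M) (γc η γlo γhi : ℝ) (yin : M)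
    (y : ℕ → M) (γ : ℕ → ℝ) (s : ∀ k, TangentSpace I (y k)) : Prop where
  init : y 0 = Φ yin
  init_param : γ 0 ∈ Icc γlo γhi
  step_norm : ∀ k, ‖s k‖ ≤ radius g R (y k) (γ k)
  step_model : ∀ k, ∃ sc : TangentSpace I (y k), IsCauchyStep g R (y k) (γ k) sc ∧
    quadModel (pullback g R (y k)) (s k) ≤ quadModel (pullback g R (y k)) sc
  success : ∀ k, η ≤ decreaseRatio g R (y k) (s k) →
    y (k + 1) = Φ (R ⟨y k, s k⟩) ∧ γ (k + 1) ∈ Icc γlo γhi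
  failure : ∀ k, decreaseRatio g R (y k) (s k) < η →
    y (k + 1) = y k ∧ γ (k + 1) = γc * γ k

/-- The Lipschitz-type assumption on the pullbacks along a run, with constants `L₁`, `L₂`. -/
structure PullbackLipschitz (L₁ L₂ : ℝ) (y : ℕ → M) (s : ∀ k, TangentSpace I (y k)) : Prop where
  hessian_bound : ∀ k, ‖pullbackHessian g R (y k)‖ ≤ L₁
  first_order : ∀ k,
    |g (R ⟨y k, s k⟩) - g (y k) - ⟪s k, riemannianGradient I g (y k)⟫_ℝ| ≤ L₁ / 2 * ‖s k‖ ^ 2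
  second_order : ∀ k,
    |g (R ⟨y k, s k⟩) - g (y k) - ⟪s k, riemannianGradient I g (y k)⟫_ℝ
        - (1 / 2) * ⟪s k, pullbackHessian g R (y k) (s k)⟫_ℝ| ≤ L₂ / 6 * ‖s k‖ ^ 3

end Algorithm

end Riemannian

/-- `γ_min = min(γlo, γc / (1 + L₁), γc (1 - η) / (2 L₁), 3 γc (1 - η) / L₂)`, computed in `[0, ∞]`
so that a fraction with positive numerator and zero denominator is `∞`. -/
def gammaMin (γc η γlo L₁ L₂ : ℝ) : ℝ :=
  (min (min (ENNReal.ofReal γlo) (ENNReal.ofReal γc / ENNReal.ofReal (1 + L₁)))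
    (min (ENNReal.ofReal (γc * (1 - η)) / ENNReal.ofReal (2 * L₁))
      (ENNReal.ofReal (3 * γc * (1 - η)) / ENNReal.ofReal L₂))).toReal

/-- `κ_min = η γ_min² / 2`. -/
def kappaMin (γc η γlo L₁ L₂ : ℝ) : ℝ :=
  (1 / 2) * η * gammaMin γc η γlo L₁ L₂ ^ 2

end

/-! Everything rests on two facts about a single iteration. Along the negative gradient or the
left-most eigenvector, the quadratic model decreases by a multiple of `‖∇g‖²` or `|λ₋|³`
(`quadModel_decrease_of_gradient`, `quadModel_decrease_of_curvature`). The test choosing the branch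
compares exactly these two quantities, so a successful step lowers the cost by at least `κ_min * max
(‖∇g‖²) (|λ₋|³)` (`cost_decrease_of_success`), and the hook can only lower it further.

Conversely, the radius is proportional to the chosen quantity. The Taylor error is then at most a
fraction `1 - η` of the model decrease once `γ` is small, and the step succeeds
(`success_of_small`). Hence `γ` never falls below `γ_min` (`radiusParam_mem_Icc`), which bounds the
length of a run of failures. Failures do not move the iterate, so each noncritical index lies
shortly before a successful noncritical one, and there are few of those because the cost is bounded
below (`finite_and_ncard_le_of_success_decrease`).

By finiteness for every tolerance, `‖∇g‖` and `|λ₋|` tend to zero along the run. In a chart, the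
first and second derivatives of the pullbacks at the origin depend continuously on the base point,
so both conditions pass to accumulation points (`criticality_of_mapClusterPt`). Where the
differential vanishes, the second derivative along a curve depends only on its velocity
(`deriv_deriv_comp_curve_congr`), so a retraction curve can replace an arbitrary one. -/

/-! ### Counting successes and runs of failures. -/

section Counting

/-- If a nonincreasing sequence drops by at least `d` at each index of `T`, a finite part of `T`
has a number of elements controlled by the total decrease. -/
lemma card_mul_le_total_decrease {v : ℕ → ℝ} (hv : Antitone v) {T : Set ℕ} {d : ℝ}
    (hT : ∀ k ∈ T, v (k + 1) ≤ v k - d) {vmin : ℝ} (hmin : ∀ k, vmin ≤ v k)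
    (F : Finset ℕ) (hF : (F : Set ℕ) ⊆ T) : (F.card : ℝ) * d ≤ v 0 - vmin := by
  classical
  -- Only the drops at indices of `F` below `n` are counted; all other indices are covered by
  -- monotonicity.
  have key : ∀ n, ((F.filter (· < n)).card : ℝ) * d ≤ v 0 - v n := by
    intro n
    induction n with
    | zero => simp
    | succ n ih =>
      by_cases hn : n ∈ F
      · have h : F.filter (· < n + 1) = insert n (F.filter (· < n)) := by
          ext k
          simp only [Finset.mem_filter, Finset.mem_insert]
          constructor
          · rintro ⟨h1, h2⟩
            rcases Nat.lt_succ_iff_lt_or_eq.1 h2 with h | h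
            · exact Or.inr ⟨h1, h⟩
            · exact Or.inl h
          · rintro (rfl | ⟨h1, h2⟩)
            · exact ⟨hn, Nat.lt_succ_self _⟩
            · exact ⟨h1, h2.trans (Nat.lt_succ_self _)⟩
        rw [h, Finset.card_insert_of_notMem (by simp)]
        push_cast
        linarith [hT n (hF hn)]
      · have h : F.filter (· < n + 1) = F.filter (· < n) := by
          ext k
          simp only [Finset.mem_filter, and_congr_right_iff]
          intro hk
          have : k ≠ n := fun h => hn (h ▸ hk)
          omega
        rw [h]
        linarith [hv n.le_succ]
  have h := key (F.sup id + 1)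
  have hF' : F.filter (· < F.sup id + 1) = F :=
    Finset.filter_true_of_mem fun k hk => Nat.lt_succ_of_le (Finset.le_sup (f := id) hk)
  rw [hF'] at h
  linarith [hmin (F.sup id + 1)]

/-- Counting argument for adaptive-radius methods: among the iterations satisfying `P`, successful
ones (`S`) decrease `v` by at least `d`, and failures preserve `P` and shrink `γ`. -/
theorem finite_and_ncard_le_of_success_decrease {P S : ℕ → Prop} {v γ : ℕ → ℝ}
    {γc γmin γhi d vmin : ℝ} (hγc : γc ∈ Ioo (0 : ℝ) 1) (hγmin : 0 < γmin)
    (hγ : ∀ k, γ k ∈ Icc γmin γhi)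
    (hfail : ∀ k, ¬ S k → γ (k + 1) = γc * γ k ∧ (P k → P (k + 1)))
    (hv : Antitone v) (hmin : ∀ k, vmin ≤ v k) (hd : 0 < d)
    (hsucc : ∀ k, S k → P k → v (k + 1) ≤ v k - d) :
    {k | P k}.Finite ∧ ({k | P k}.ncard : ℤ) ≤
      ⌈Real.logb γc (γmin / γhi) + 1⌉ * ⌊(v 0 - vmin) / d⌋ := by
  have hhi : 0 < γhi := hγmin.trans_le ((hγ 0).1.trans (hγ 0).2)
  set T : Set ℕ := {k | S k ∧ P k} with hTdef
  have hlog : 0 ≤ Real.logb γc (γmin / γhi) :=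
    Real.logb_nonneg_of_base_lt_one hγc.1 hγc.2 (div_pos hγmin hhi)
      ((div_le_one hhi).2 ((hγ 0).1.trans (hγ 0).2))
  -- `J` will bound the waiting time until a success, and `N` the number of successes in `P`.
  obtain ⟨J, hJ⟩ := Int.eq_ofNat_of_zero_le
    (Int.ceil_nonneg (by linarith : 0 ≤ Real.logb γc (γmin / γhi) + 1))
  obtain ⟨N, hN⟩ := Int.eq_ofNat_of_zero_le
    (Int.floor_nonneg.2 (div_nonneg (sub_nonneg.2 (hmin 0)) hd.le))
  have hcard : ∀ F : Finset ℕ, (F : Set ℕ) ⊆ T → F.card ≤ N := by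
    intro F hF
    have h := card_mul_le_total_decrease hv (fun k hk => hsucc k hk.1 hk.2) hmin F hF
    have h2 : ((F.card : ℤ) : ℝ) ≤ (v 0 - vmin) / d := by
      rw [le_div_iff₀ hd]; exact_mod_cast h
    have := Int.le_floor.2 h2
    rw [hN] at this
    exact_mod_cast this
  have hTfin : T.Finite := by
    by_contra h
    obtain ⟨F, hF, hc⟩ := Set.Infinite.exists_subset_card_eq h (N + 1)
    have := hcard F hF
    omega
  -- The `+ 1` inside the ceiling puts the logarithm strictly below `J`, which makes this inequality
  -- strict.
  have hpow : γc ^ J * γhi < γmin := by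
    have h1 : Real.logb γc (γmin / γhi) + 1 ≤ J := by
      have := Int.le_ceil (Real.logb γc (γmin / γhi) + 1)
      rw [hJ] at this
      exact_mod_cast this
    rw [← lt_div_iff₀ hhi, ← Real.rpow_natCast,
      ← Real.logb_lt_iff_lt_rpow_of_base_lt_one hγc.1 hγc.2 (div_pos hγmin hhi)]
    linarith
  -- `J` failures in a row would multiply `γ` by `γc ^ J` and push it below `γmin`.
  have hnext : ∀ k, P k → ∃ j < J, k + j ∈ T := by
    intro k hk
    by_contra! hcon
    have hall : ∀ j ≤ J, P (k + j) ∧ γ (k + j) = γc ^ j * γ k := by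
      intro j
      induction j with
      | zero => simp [hk]
      | succ j ih =>
        intro hj
        obtain ⟨h1, h2⟩ := ih (by omega)
        have hS : ¬ S (k + j) := fun hS => hcon j (by omega) ⟨hS, h1⟩
        obtain ⟨h3, h4⟩ := hfail _ hS
        refine ⟨h4 h1, ?_⟩
        rw [← add_assoc, h3, h2, pow_succ]
        ring
    have h := (hall J le_rfl).2
    have h1 := (hγ (k + J)).1
    have h2 : γc ^ J * γ k ≤ γc ^ J * γhi :=
      mul_le_mul_of_nonneg_left (hγ k).2 (pow_nonneg hγc.1.le _)
    linarith
  -- Each index satisfying `P` is an element of `T` minus an offset below `J`, hence at most `N * J`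
  -- of them.
  have hsub : {k | P k} ⊆
      ((hTfin.toFinset ×ˢ Finset.range J).image (fun q => q.1 - q.2) : Finset ℕ) := by
    intro k hk
    obtain ⟨j, hj, hT⟩ := hnext k hk
    simp only [Finset.coe_image, Finset.coe_product, mem_image]
    exact ⟨(k + j, j), ⟨by simpa using hT, by simpa using hj⟩, by simp⟩
  have hTcard : hTfin.toFinset.card ≤ N := hcard _ (by simp)
  refine ⟨(Finset.finite_toSet _).subset hsub, ?_⟩
  have h1 := Set.ncard_le_ncard hsub (Finset.finite_toSet _)
  rw [Set.ncard_coe_finset] at h1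
  have h2 := h1.trans Finset.card_image_le
  rw [Finset.card_product, Finset.card_range] at h2
  have h3 := h2.trans (Nat.mul_le_mul_right J hTcard)
  rw [hJ, hN]
  calc ({k | P k}.ncard : ℤ) ≤ ((N * J : ℕ) : ℤ) := by exact_mod_cast h3
    _ = _ := by push_cast; ring

end Counting

/-! ### The threshold for the radius parameter. -/

section Parameters

variable {γc η γlo L₁ L₂ : ℝ}

lemma gammaMin_pos (hγc : 0 < γc) (hη : η < 1) (hγlo : 0 < γlo) :
    0 < gammaMin γc η γlo L₁ L₂ := by
  unfold gammaMin
  refine ENNReal.toReal_pos ?_ ?_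
  · refine (lt_min (lt_min ?_ ?_) (lt_min ?_ ?_)).ne'
    · exact ENNReal.ofReal_pos.2 hγlo
    · exact ENNReal.div_pos (ENNReal.ofReal_pos.2 hγc).ne' ENNReal.ofReal_ne_top
    · exact ENNReal.div_pos (ENNReal.ofReal_pos.2 (mul_pos hγc (by linarith))).ne'
        ENNReal.ofReal_ne_top
    · exact ENNReal.div_pos
        (ENNReal.ofReal_pos.2 (mul_pos (by linarith) (by linarith))).ne' ENNReal.ofReal_ne_top
  · exact ((min_le_left _ _).trans (min_le_left _ _)).trans_lt ENNReal.ofReal_lt_top |>.ne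

lemma gammaMin_le_gammaLo (hγlo : 0 < γlo) : gammaMin γc η γlo L₁ L₂ ≤ γlo := by
  unfold gammaMin
  exact ENNReal.toReal_le_of_le_ofReal hγlo.le ((min_le_left _ _).trans (min_le_left _ _))

lemma gammaMin_le_div (hγc : 0 < γc) (hL₁ : 0 ≤ L₁) :
    gammaMin γc η γlo L₁ L₂ ≤ γc / (1 + L₁) := by
  unfold gammaMin
  refine ENNReal.toReal_le_of_le_ofReal (by positivity) ?_
  rw [ENNReal.ofReal_div_of_pos (by linarith)]
  exact (min_le_left _ _).trans (min_le_right _ _)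

lemma gammaMin_lt_one (hγc : γc ∈ Ioo (0 : ℝ) 1) (hL₁ : 0 ≤ L₁) :
    gammaMin γc η γlo L₁ L₂ < 1 := by
  refine (gammaMin_le_div hγc.1 hL₁).trans_lt ?_
  rw [div_lt_one (by linarith)]
  linarith [hγc.2]

lemma gammaMin_mul_le_one (hγc : γc ∈ Ioo (0 : ℝ) 1) (hL₁ : 0 ≤ L₁) :
    gammaMin γc η γlo L₁ L₂ * L₁ ≤ 1 := by
  have h := gammaMin_le_div (η := η) (γlo := γlo) (L₂ := L₂) hγc.1 hL₁
  have h2 : γc / (1 + L₁) * L₁ ≤ 1 := by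
    rw [div_mul_eq_mul_div, div_le_one (by linarith)]
    nlinarith [hγc.2]
  exact (mul_le_mul_of_nonneg_right h hL₁).trans h2

/-- A radius parameter whose reduction falls below `gammaMin` (but stays below the reset interval)
satisfies the smallness conditions that make a step successful. -/
lemma small_of_mul_lt_gammaMin {γ : ℝ} (hγc : γc ∈ Ioo (0 : ℝ) 1) (hη : η < 1) (hγ : 0 < γ)
    (hL₁ : 0 ≤ L₁) (hL₂ : 0 ≤ L₂) (h : γc * γ < gammaMin γc η γlo L₁ L₂) :
    γ * L₁ ≤ 1 ∧ 2 * L₁ * γ ≤ 1 - η ∧ L₂ * γ ≤ 3 * (1 - η) := by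
  obtain ⟨h0, h1⟩ := hγc
  have hfin : (min (min (ENNReal.ofReal γlo) (ENNReal.ofReal γc / ENNReal.ofReal (1 + L₁)))
    (min (ENNReal.ofReal (γc * (1 - η)) / ENNReal.ofReal (2 * L₁))
      (ENNReal.ofReal (3 * γc * (1 - η)) / ENNReal.ofReal L₂))) ≠ ⊤ :=
    (((min_le_left _ _).trans (min_le_left _ _)).trans_lt ENNReal.ofReal_lt_top).ne
  have hE := (ENNReal.ofReal_lt_iff_lt_toReal (by positivity) hfin).2 h
  simp only [lt_min_iff] at hE
  obtain ⟨⟨-, hA⟩, hB, hC⟩ := hE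
  -- When `b = 0` the quotient carries no information, but the cross-multiplied inequality reduces
  -- to `0 ≤ a`.
  have cross : ∀ a b : ℝ, 0 ≤ b → ENNReal.ofReal (γc * γ) < ENNReal.ofReal a / ENNReal.ofReal b →
      0 ≤ a → γc * γ * b ≤ a := by
    intro a b hb hlt ha
    rcases hb.eq_or_lt with rfl | hb
    · simpa using ha
    · rw [← ENNReal.ofReal_div_of_pos hb] at hlt
      have := (ENNReal.ofReal_lt_ofReal_iff_of_nonneg (by positivity)).1 hlt
      exact ((lt_div_iff₀ hb).1 this).le
  have hA' := cross _ _ (by linarith) hA h0.le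
  have hB' := cross _ _ (by linarith) hB (mul_nonneg h0.le (by linarith))
  have hC' := cross _ _ hL₂ hC (mul_nonneg (by linarith) (by linarith))
  refine ⟨?_, ?_, ?_⟩
  · refine le_of_mul_le_mul_left ?_ h0
    nlinarith [mul_pos h0 hγ]
  · refine le_of_mul_le_mul_left ?_ h0
    nlinarith
  · refine le_of_mul_le_mul_left ?_ h0
    nlinarith

end Parameters

/-! ### Decrease of the quadratic model at the Cauchy point. -/

section Model

variable {V : Type*} [NormedAddCommGroup V] [InnerProductSpace ℝ V] [CompleteSpace V]

lemma quadModel_zero (f : V → ℝ) : quadModel f 0 = f 0 := by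
  simp [quadModel]

omit [CompleteSpace V] in
lemma abs_inner_apply_self_le {A : V →L[ℝ] V} {L : ℝ} (hA : ‖A‖ ≤ L) (s : V) :
    |⟪s, A s⟫_ℝ| ≤ L * ‖s‖ ^ 2 := by
  calc |⟪s, A s⟫_ℝ| ≤ ‖s‖ * ‖A s‖ := abs_real_inner_le_norm _ _
    _ ≤ ‖s‖ * (L * ‖s‖) := by gcongr; exact A.le_of_opNorm_le hA s
    _ = _ := by ring

/-- Model decrease at the Cauchy point along the negative gradient. -/
lemma quadModel_decrease_of_gradient {f : V → ℝ} {L τ δ t : ℝ} (hA : ‖hessianAt f 0‖ ≤ L)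
    (hτ : 0 ≤ τ) (hτL : τ * L ≤ 1) (hτδ : τ * ‖∇ f 0‖ ≤ δ)
    (ht : IsMinOn (fun r : ℝ => quadModel f (r • -∇ f 0)) {r | 0 ≤ r ∧ ‖r • -∇ f 0‖ ≤ δ} t) :
    1 / 2 * τ * ‖∇ f 0‖ ^ 2 ≤ quadModel f 0 - quadModel f (t • -∇ f 0) := by
  have hmem : τ ∈ {r : ℝ | 0 ≤ r ∧ ‖r • -∇ f 0‖ ≤ δ} := by
    refine ⟨hτ, ?_⟩
    rwa [norm_smul, norm_neg, Real.norm_of_nonneg hτ]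
  have h1 := ht hmem
  have h2 := abs_inner_apply_self_le hA (∇ f 0)
  have h3 : quadModel f (τ • -∇ f 0) =
      f 0 - τ * ‖∇ f 0‖ ^ 2 + 1 / 2 * τ ^ 2 * ⟪∇ f 0, hessianAt f 0 (∇ f 0)⟫_ℝ := by
    simp only [quadModel, map_smul, map_neg, inner_smul_left, inner_smul_right, inner_neg_left,
      inner_neg_right, real_inner_self_eq_norm_sq, conj_trivial]
    ring
  rw [quadModel_zero]
  simp only [mem_ofPred_eq] at h1
  rw [h3] at h1
  -- Since `τ * L ≤ 1`, the curvature term cancels at most half of the linear decrease.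
  have h4 : τ ^ 2 * ⟪∇ f 0, hessianAt f 0 (∇ f 0)⟫_ℝ ≤ τ * ‖∇ f 0‖ ^ 2 := by
    calc τ ^ 2 * ⟪∇ f 0, hessianAt f 0 (∇ f 0)⟫_ℝ
        ≤ τ ^ 2 * (L * ‖∇ f 0‖ ^ 2) := by gcongr; exact (le_abs_self _).trans h2
      _ = τ * ‖∇ f 0‖ ^ 2 * (τ * L) := by ring
      _ ≤ τ * ‖∇ f 0‖ ^ 2 * 1 := by gcongr
      _ = _ := mul_one _
  linarith

/-- Model decrease at the Cauchy point along a direction of negative curvature. -/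
lemma quadModel_decrease_of_curvature {f : V → ℝ} {u : V} {l δ t : ℝ} (hu : ‖u‖ = 1)
    (hl : hessianAt f 0 u = (-l) • u) (hg : ⟪u, ∇ f 0⟫_ℝ ≤ 0) (hδ : 0 ≤ δ)
    (ht : IsMinOn (fun r : ℝ => quadModel f (r • u)) {r | 0 ≤ r ∧ ‖r • u‖ ≤ δ} t) :
    1 / 2 * l * δ ^ 2 ≤ quadModel f 0 - quadModel f (t • u) := by
  have hmem : δ ∈ {r : ℝ | 0 ≤ r ∧ ‖r • u‖ ≤ δ} := by
    refine ⟨hδ, ?_⟩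
    rw [norm_smul, hu, Real.norm_of_nonneg hδ, mul_one]
  have h1 := ht hmem
  have h3 : quadModel f (δ • u) = f 0 + δ * ⟪u, ∇ f 0⟫_ℝ - 1 / 2 * l * δ ^ 2 := by
    simp only [quadModel, map_smul, hl, inner_smul_left, inner_smul_right,
      real_inner_self_eq_norm_sq, conj_trivial, hu]
    ring
  rw [quadModel_zero]
  simp only [mem_ofPred_eq] at h1
  rw [h3] at h1
  nlinarith [mul_nonneg hδ (neg_nonneg.2 hg)]

end Model

/-! ### Analysis of one iteration. -/

section Step

variable {E : Type*} [NormedAddCommGroup E] [NormedSpace ℝ E] [FiniteDimensional ℝ E]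
  {H : Type*} [TopologicalSpace H] {I : ModelWithCorners ℝ E H}
  {M : Type*} [TopologicalSpace M] [ChartedSpace H M]
  [RiemannianBundle (fun x : M => TangentSpace I x)]
  {g : M → ℝ} {R : TangentBundle I M → M} {y : M}

lemma abs_lamNeg_of_usesCurvature (h : UsesCurvature g R y) : |lamNeg g R y| = -lam g R y := by
  rw [lamNeg, min_eq_left h.1.le, abs_of_neg h.1]

lemma abs_lamNeg_pow_le_of_not_usesCurvature (h : ¬ UsesCurvature g R y) :
    |lamNeg g R y| ^ 3 ≤ ‖riemannianGradient I g y‖ ^ 2 := by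
  by_cases hl : lam g R y < 0
  · exact not_lt.1 fun h' => h ⟨hl, h'⟩
  · rw [lamNeg, min_eq_right (not_lt.1 hl)]
    simp

lemma radius_nonneg {γ : ℝ} (hγ : 0 ≤ γ) : 0 ≤ radius g R y γ := by
  unfold radius
  split_ifs <;> positivity

/-- The trial length `τ` is kept separate from `γ` because `γ * L ≤ 1` may fail for a large radius
parameter. The decrease estimate applies this with `τ` equal to `gammaMin`, the success criterion
with `τ = γ`. -/
lemma model_decrease {γ τ L : ℝ} {s : TangentSpace I y}
    (hgrad : ∇ (pullback g R y) 0 = riemannianGradient I g y)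
    (hH : ‖pullbackHessian g R y‖ ≤ L) (hγ : 0 ≤ γ) (hτ : 0 ≤ τ) (hτγ : τ ≤ γ) (hτL : τ * L ≤ 1)
    (hs : ∃ sc : TangentSpace I y, IsCauchyStep g R y γ sc ∧
      quadModel (pullback g R y) s ≤ quadModel (pullback g R y) sc) :
    (UsesCurvature g R y → 1 / 2 * γ ^ 2 * |lamNeg g R y| ^ 3 ≤
      quadModel (pullback g R y) 0 - quadModel (pullback g R y) s) ∧
    (¬ UsesCurvature g R y → 1 / 2 * τ * ‖riemannianGradient I g y‖ ^ 2 ≤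
      quadModel (pullback g R y) 0 - quadModel (pullback g R y) s) := by
  obtain ⟨sc, ⟨u, t, hu, -, hmin, rfl⟩, hle⟩ := hs
  constructor
  · intro hc
    obtain ⟨h1, h2, h3⟩ := hu.1 hc
    have hδ : radius g R y γ = γ * |lamNeg g R y| := if_pos hc
    have h := quadModel_decrease_of_curvature (l := |lamNeg g R y|) h1
      (by rw [abs_lamNeg_of_usesCurvature hc, neg_neg]; exact h2) (by rw [hgrad]; exact h3)
      (radius_nonneg hγ) hmin
    rw [hδ] at h
    linarith
  · intro hc
    obtain rfl := hu.2 hc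
    have hδ : radius g R y γ = γ * ‖riemannianGradient I g y‖ := if_neg hc
    rw [← hgrad] at hmin hle hδ ⊢
    have h := quadModel_decrease_of_gradient hH hτ hτL
      (by rw [hδ]; gcongr) hmin
    linarith

/-- A successful step decreases the cost by a multiple of the squared gradient norm or of the
cubed negative curvature, whichever is larger. -/
lemma cost_decrease_of_success {γ τ L η : ℝ} {s : TangentSpace I y}
    (hgrad : ∇ (pullback g R y) 0 = riemannianGradient I g y) (hR : R ⟨y, 0⟩ = y)
    (hH : ‖pullbackHessian g R y‖ ≤ L) (hη : 0 < η) (hτ : 0 < τ) (hτγ : τ ≤ γ) (hτL : τ * L ≤ 1)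
    (hτ1 : τ ≤ 1) (hsr : ‖s‖ ≤ radius g R y γ)
    (hs : ∃ sc : TangentSpace I y, IsCauchyStep g R y γ sc ∧
      quadModel (pullback g R y) s ≤ quadModel (pullback g R y) sc)
    (hρ : η ≤ decreaseRatio g R y s) :
    1 / 2 * η * τ ^ 2 * max (‖riemannianGradient I g y‖ ^ 2) (|lamNeg g R y| ^ 3) ≤
      g y - g (R ⟨y, s⟩) := by
  obtain ⟨hA, hB⟩ := model_decrease hgrad hH (hτ.le.trans hτγ) hτ.le hτγ hτL hs
  -- The gradient branch yields a factor `τ` and the curvature branch `γ ^ 2`; both dominate `τ ^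
  -- 2`.
  have hsq : τ ^ 2 ≤ τ := by nlinarith
  have hlow : 1 / 2 * τ ^ 2 * max (‖riemannianGradient I g y‖ ^ 2) (|lamNeg g R y| ^ 3) ≤
      quadModel (pullback g R y) 0 - quadModel (pullback g R y) s := by
    by_cases hc : UsesCurvature g R y
    · rw [max_eq_right hc.2.le]
      refine le_trans ?_ (hA hc)
      gcongr
    · rw [max_eq_left (abs_lamNeg_pow_le_of_not_usesCurvature hc)]
      refine le_trans ?_ (hB hc)
      gcongr
  unfold decreaseRatio at hρ
  split_ifs at hρ with h0
  -- When the ratio is `1` by convention, the model decrease is zero. This forces gradient and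
  -- negative curvature to vanish, so the radius is zero, `s = 0`, and both sides of the goal are
  -- zero.
  · rw [h0] at hlow hA hB
    have hmax : max (‖riemannianGradient I g y‖ ^ 2) (|lamNeg g R y| ^ 3) ≤ 0 := by
      by_contra! h
      have : 0 < 1 / 2 * τ ^ 2 * max (‖riemannianGradient I g y‖ ^ 2) (|lamNeg g R y| ^ 3) := by
        positivity
      linarith
    have hG : ‖riemannianGradient I g y‖ = 0 := by
      have := (le_max_left _ _).trans hmax
      nlinarith [norm_nonneg (riemannianGradient I g y)]
    have hl : |lamNeg g R y| = 0 := by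
      have := (le_max_right _ _).trans hmax
      by_contra h
      have : 0 < |lamNeg g R y| ^ 3 := by positivity
      linarith
    have hr : radius g R y γ = 0 := by
      unfold radius
      rw [hG, hl]
      simp
    have hs0 : s = 0 := norm_le_zero_iff.1 (hsr.trans hr.le)
    rw [hs0, hR, hG, hl]
    simp
  · have hpos : 0 < quadModel (pullback g R y) 0 - quadModel (pullback g R y) s :=
      lt_of_le_of_ne (le_trans (by positivity) hlow) (Ne.symm h0)
    rw [le_div_iff₀ hpos] at hρ
    calc _ = η * (1 / 2 * τ ^ 2 *
          max (‖riemannianGradient I g y‖ ^ 2) (|lamNeg g R y| ^ 3)) := by ring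
      _ ≤ η * (quadModel (pullback g R y) 0 - quadModel (pullback g R y) s) := by gcongr
      _ ≤ _ := hρ

/-- A step is successful if the radius parameter is small enough. -/
lemma success_of_small {γ L₁ L₂ η : ℝ} {s : TangentSpace I y}
    (hgrad : ∇ (pullback g R y) 0 = riemannianGradient I g y) (hR : R ⟨y, 0⟩ = y)
    (hH : ‖pullbackHessian g R y‖ ≤ L₁)
    (h1 : |g (R ⟨y, s⟩) - g y - ⟪s, riemannianGradient I g y⟫_ℝ| ≤ L₁ / 2 * ‖s‖ ^ 2)
    (h2 : |g (R ⟨y, s⟩) - g y - ⟪s, riemannianGradient I g y⟫_ℝ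
        - (1 / 2) * ⟪s, pullbackHessian g R y s⟫_ℝ| ≤ L₂ / 6 * ‖s‖ ^ 3)
    (hη1 : η ≤ 1) (hL₁ : 0 ≤ L₁) (hL₂ : 0 ≤ L₂) (hγ : 0 < γ) (hγL : γ * L₁ ≤ 1)
    (hγ₁ : 2 * L₁ * γ ≤ 1 - η) (hγ₂ : L₂ * γ ≤ 3 * (1 - η)) (hsr : ‖s‖ ≤ radius g R y γ)
    (hs : ∃ sc : TangentSpace I y, IsCauchyStep g R y γ sc ∧
      quadModel (pullback g R y) s ≤ quadModel (pullback g R y) sc) :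
    η ≤ decreaseRatio g R y s := by
  obtain ⟨hA, hB⟩ := model_decrease hgrad hH hγ.le hγ.le le_rfl hγL hs
  unfold decreaseRatio
  split_ifs with h0
  · exact hη1
  have hq0 : quadModel (pullback g R y) 0 = g y := by
    rw [quadModel_zero, pullback, hR]
  have hqs : quadModel (pullback g R y) s = g y + ⟪s, riemannianGradient I g y⟫_ℝ
      + (1 / 2) * ⟪s, pullbackHessian g R y s⟫_ℝ := by
    rw [quadModel, hgrad, pullback, hR, pullbackHessian]
  set D := quadModel (pullback g R y) 0 - quadModel (pullback g R y) s with hD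
  have hDnn : 0 ≤ D := by
    by_cases hc : UsesCurvature g R y
    · exact le_trans (by positivity) (hA hc)
    · exact le_trans (by positivity) (hB hc)
  rw [le_div_iff₀ (lt_of_le_of_ne hDnn (Ne.symm h0))]
  -- The model is exact at the origin, so actual decrease equals `D` minus the model error at `s`.
  suffices h : g (R ⟨y, s⟩) - quadModel (pullback g R y) s ≤ (1 - η) * D by
    linarith
  by_cases hc : UsesCurvature g R y
  · have hr : radius g R y γ = γ * |lamNeg g R y| := if_pos hc
    have hsr' : ‖s‖ ^ 3 ≤ (γ * |lamNeg g R y|) ^ 3 := by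
      rw [← hr]; gcongr
    calc g (R ⟨y, s⟩) - quadModel (pullback g R y) s ≤ L₂ / 6 * ‖s‖ ^ 3 := by
          rw [hqs]
          linarith [le_abs_self (g (R ⟨y, s⟩) - g y - ⟪s, riemannianGradient I g y⟫_ℝ
            - (1 / 2) * ⟪s, pullbackHessian g R y s⟫_ℝ)]
      _ ≤ L₂ / 6 * (γ * |lamNeg g R y|) ^ 3 := by gcongr
      _ = (L₂ * γ) * (1 / 6 * γ ^ 2 * |lamNeg g R y| ^ 3) := by ring
      _ ≤ (3 * (1 - η)) * (1 / 6 * γ ^ 2 * |lamNeg g R y| ^ 3) := by gcongr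
      _ = (1 - η) * (1 / 2 * γ ^ 2 * |lamNeg g R y| ^ 3) := by ring
      _ ≤ (1 - η) * D := mul_le_mul_of_nonneg_left (hA hc) (by linarith)
  · have hr : radius g R y γ = γ * ‖riemannianGradient I g y‖ := if_neg hc
    have hsr' : ‖s‖ ^ 2 ≤ (γ * ‖riemannianGradient I g y‖) ^ 2 := by
      rw [← hr]; gcongr
    -- Half of `L₁` comes from the first-order remainder, half from the Hessian term of the model. A
    -- cubic bound would not fit here, as the model decrease is only quadratic in the gradient norm.
    calc g (R ⟨y, s⟩) - quadModel (pullback g R y) s ≤ L₁ * ‖s‖ ^ 2 := by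
          rw [hqs]
          linarith [le_abs_self (g (R ⟨y, s⟩) - g y - ⟪s, riemannianGradient I g y⟫_ℝ),
            neg_abs_le ⟪s, pullbackHessian g R y s⟫_ℝ, abs_inner_apply_self_le hH s]
      _ ≤ L₁ * (γ * ‖riemannianGradient I g y‖) ^ 2 := by gcongr
      _ = (2 * L₁ * γ) * (1 / 2 * γ * ‖riemannianGradient I g y‖ ^ 2) := by ring
      _ ≤ (1 - η) * (1 / 2 * γ * ‖riemannianGradient I g y‖ ^ 2) := by gcongr
      _ ≤ (1 - η) * D := mul_le_mul_of_nonneg_left (hB hc) (by linarith)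

end Step

/-! ### Radius lower bound and iteration complexity. -/

section Run

variable {E : Type*} [NormedAddCommGroup E] [NormedSpace ℝ E] [FiniteDimensional ℝ E]
  {H : Type*} [TopologicalSpace H] {I : ModelWithCorners ℝ E H}
  {M : Type*} [TopologicalSpace M] [ChartedSpace H M]
  [RiemannianBundle (fun x : M => TangentSpace I x)]
  {g : M → ℝ} {R : TangentBundle I M → M} {Φ : M → M} {γc η γlo γhi L₁ L₂ : ℝ} {yin : M}
  {y : ℕ → M} {γ : ℕ → ℝ} {s : ∀ k, TangentSpace I (y k)}

/-- Success resets the parameter into `[γlo, γhi]`. A failure that took it below `gammaMin` would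
start from a value small enough to guarantee success. -/
lemma radiusParam_mem_Icc (hgrad : ∀ z : M, ∇ (pullback g R z) 0 = riemannianGradient I g z)
    (hR : ∀ z : M, R ⟨z, 0⟩ = z) (hγc : γc ∈ Ioo (0 : ℝ) 1) (hη : η ∈ Ioo (0 : ℝ) 1)
    (hγlo : 0 < γlo) (hrun : IsHookedTrustRegionRun g R Φ γc η γlo γhi yin y γ s)
    (hL₁ : 0 ≤ L₁) (hL₂ : 0 ≤ L₂) (hLip : PullbackLipschitz g R L₁ L₂ y s) (k : ℕ) :
    γ k ∈ Icc (gammaMin γc η γlo L₁ L₂) γhi := by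
  have hpos := gammaMin_pos (L₁ := L₁) (L₂ := L₂) hγc.1 hη.2 hγlo
  have hle := gammaMin_le_gammaLo (γc := γc) (η := η) (L₁ := L₁) (L₂ := L₂) hγlo
  induction k with
  | zero => exact ⟨hle.trans hrun.init_param.1, hrun.init_param.2⟩
  | succ k ih =>
    have hγk : 0 < γ k := hpos.trans_le ih.1
    rcases le_or_gt η (decreaseRatio g R (y k) (s k)) with h | h
    · have := (hrun.success k h).2
      exact ⟨hle.trans this.1, this.2⟩
    · rw [(hrun.failure k h).2]
      refine ⟨?_, by nlinarith [hγc.2, ih.2]⟩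
      by_contra! hlt
      obtain ⟨h1, h2, h3⟩ := small_of_mul_lt_gammaMin hγc hη.2 hγk hL₁ hL₂ hlt
      exact h.not_ge (success_of_small (hgrad _) (hR _) (hLip.hessian_bound k)
        (hLip.first_order k) (hLip.second_order k) hη.2.le hL₁ hL₂ hγk h1 h2 h3
        (hrun.step_norm k) (hrun.step_model k))

/-- Worst-case bound on the number of iterates that are not approximately second-order critical. -/
theorem iteration_complexity
    (hgrad : ∀ z : M, ∇ (pullback g R z) 0 = riemannianGradient I g z)
    (hR : ∀ z : M, R ⟨z, 0⟩ = z) (hΦ : ∀ z, g (Φ z) ≤ g z)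
    (hγc : γc ∈ Ioo (0 : ℝ) 1) (hη : η ∈ Ioo (0 : ℝ) 1)
    (hγlo : 0 < γlo) (hrun : IsHookedTrustRegionRun g R Φ γc η γlo γhi yin y γ s)
    (hL₁ : 0 ≤ L₁) (hL₂ : 0 ≤ L₂) (hLip : PullbackLipschitz g R L₁ L₂ y s)
    {gmin : ℝ} (hgmin : ∀ k, gmin ≤ g (y k)) {ε₁ ε₂ : ℝ} (hε₁ : 0 < ε₁) (hε₂ : 0 < ε₂) :
    {k : ℕ | ε₁ < ‖riemannianGradient I g (y k)‖ ∨ ε₂ < |lamNeg g R (y k)|}.Finite ∧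
      ({k : ℕ | ε₁ < ‖riemannianGradient I g (y k)‖ ∨ ε₂ < |lamNeg g R (y k)|}.ncard : ℤ) ≤
        ⌈Real.logb γc (gammaMin γc η γlo L₁ L₂ / γhi) + 1⌉ *
          ⌊(g (y 0) - gmin) / kappaMin γc η γlo L₁ L₂ * max (1 / ε₁ ^ 2) (1 / ε₂ ^ 3)⌋ := by
  have hpos := gammaMin_pos (L₁ := L₁) (L₂ := L₂) hγc.1 hη.2 hγlo
  have hmem := radiusParam_mem_Icc hgrad hR hγc hη hγlo hrun hL₁ hL₂ hLip
  have hκ : 0 < kappaMin γc η γlo L₁ L₂ := by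
    have := hη.1
    unfold kappaMin
    positivity
  have hdec : ∀ k, η ≤ decreaseRatio g R (y k) (s k) →
      kappaMin γc η γlo L₁ L₂ *
        max (‖riemannianGradient I g (y k)‖ ^ 2) (|lamNeg g R (y k)| ^ 3) ≤
      g (y k) - g (y (k + 1)) := by
    intro k hk
    have h := cost_decrease_of_success (hgrad (y k)) (hR _) (hLip.hessian_bound k) hη.1 hpos
      (hmem k).1 (gammaMin_mul_le_one hγc hL₁) (gammaMin_lt_one hγc hL₁).le
      (hrun.step_norm k) (hrun.step_model k) hk
    have h2 := hΦ (R ⟨y k, s k⟩)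
    rw [← (hrun.success k hk).1] at h2
    unfold kappaMin
    linarith
  have hanti : Antitone fun k => g (y k) := by
    refine antitone_nat_of_succ_le fun k => ?_
    rcases le_or_gt η (decreaseRatio g R (y k) (s k)) with h | h
    · have h1 := hdec k h
      have : 0 ≤ kappaMin γc η γlo L₁ L₂ *
        max (‖riemannianGradient I g (y k)‖ ^ 2) (|lamNeg g R (y k)| ^ 3) := by positivity
      linarith
    · rw [(hrun.failure k h).1]
  have hε : 0 < min (ε₁ ^ 2) (ε₂ ^ 3) := lt_min (by positivity) (by positivity)
  have hmax : max (1 / ε₁ ^ 2) (1 / ε₂ ^ 3) = 1 / min (ε₁ ^ 2) (ε₂ ^ 3) := by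
    rcases le_total (ε₁ ^ 2) (ε₂ ^ 3) with h | h
    · rw [min_eq_left h, max_eq_left (one_div_le_one_div_of_le (by positivity) h)]
    · rw [min_eq_right h, max_eq_right (one_div_le_one_div_of_le (by positivity) h)]
  rw [hmax, ← div_eq_mul_one_div, div_div]
  refine finite_and_ncard_le_of_success_decrease
    (S := fun k => η ≤ decreaseRatio g R (y k) (s k)) hγc hpos hmem ?_ hanti hgmin
    (mul_pos hκ hε) ?_
  · intro k hk
    obtain ⟨h1, h2⟩ := hrun.failure k (not_le.1 hk)
    exact ⟨h2, fun h => by rw [h1]; exact h⟩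
  · intro k hk hP
    have h := hdec k hk
    have hle : min (ε₁ ^ 2) (ε₂ ^ 3) ≤
        max (‖riemannianGradient I g (y k)‖ ^ 2) (|lamNeg g R (y k)| ^ 3) := by
      rcases hP with hP | hP
      · exact (min_le_left _ _).trans (le_trans (by gcongr) (le_max_left _ _))
      · exact (min_le_right _ _).trans (le_trans (by gcongr) (le_max_right _ _))
    have := mul_le_mul_of_nonneg_left hle hκ.le
    linarith

end Run

/-! ### Second derivatives, Hessians and the left-most eigenvalue. -/

section SecondDerivative

/-- Second derivative of a function along a curve. -/
lemma deriv_deriv_comp_curve {W : Type*} [NormedAddCommGroup W] [NormedSpace ℝ W] {f : W → ℝ}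
    {c : ℝ → W} {t : ℝ} (hf : ContDiffAt ℝ 2 f (c t)) (hc : ContDiffAt ℝ 2 c t) :
    deriv (deriv (f ∘ c)) t =
      fderiv ℝ (fderiv ℝ f) (c t) (deriv c t) (deriv c t) + fderiv ℝ f (c t) (deriv (deriv c) t) := by
  have hf1 : ∀ᶠ x in 𝓝 (c t), DifferentiableAt ℝ f x :=
    (hf.eventually (by simp)).mono fun x hx => hx.differentiableAt (by simp)
  have hc1 : ∀ᶠ r in 𝓝 t, DifferentiableAt ℝ c r :=
    (hc.eventually (by simp)).mono fun x hx => hx.differentiableAt (by simp)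
  have hev : deriv (f ∘ c) =ᶠ[𝓝 t] fun r => fderiv ℝ f (c r) (deriv c r) := by
    filter_upwards [hc.continuousAt.eventually hf1, hc1] with r h1 h2
    exact fderiv_comp_deriv r h1 h2
  rw [hev.deriv_eq]
  have hd1 : HasDerivAt c (deriv c t) t := hc1.self_of_nhds.hasDerivAt
  have hd2 : HasDerivAt (deriv c) (deriv (deriv c) t) t :=
    (((hc.fderiv_right (m := 1) (by norm_num)).differentiableAt (by simp)).clm_apply
      (differentiableAt_const (1 : ℝ))).hasDerivAt
  have hD : HasFDerivAt (fderiv ℝ f) (fderiv ℝ (fderiv ℝ f) (c t)) (c t) :=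
    ((hf.fderiv_right (m := 1) (by norm_num)).differentiableAt (by simp)).hasFDerivAt
  exact ((hD.comp_hasDerivAt t hd1).clm_apply hd2).deriv

variable {V : Type*} [NormedAddCommGroup V] [InnerProductSpace ℝ V] [CompleteSpace V]

lemma inner_hessianAt {f : V → ℝ} {x : V} (hf : ContDiffAt ℝ 2 f x) (u w : V) :
    ⟪hessianAt f x u, w⟫_ℝ = fderiv ℝ (fderiv ℝ f) x u w := by
  -- The inverse Riesz map is conjugate-linear by type; over `ℝ` it is repackaged as linear so that
  -- it commutes with differentiation.
  let T : StrongDual ℝ V →L[ℝ] V :=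
    { toFun := fun l => (InnerProductSpace.toDual ℝ V).symm l
      map_add' := fun a b => map_add _ a b
      map_smul' := fun r a => by simp
      cont := (InnerProductSpace.toDual ℝ V).symm.continuous }
  have hD : HasFDerivAt (fderiv ℝ f) (fderiv ℝ (fderiv ℝ f) x) x :=
    ((hf.fderiv_right (m := 1) (by norm_num)).differentiableAt (by simp)).hasFDerivAt
  have h : HasFDerivAt (fun z => ∇ f z) (T ∘L fderiv ℝ (fderiv ℝ f) x) x :=
    T.hasFDerivAt.comp x hD
  rw [hessianAt, h.fderiv]
  simp [T]

lemma hessianAt_isSymmetric {f : V → ℝ} {x : V} (hf : ContDiffAt ℝ 2 f x) :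
    (hessianAt f x : V →ₗ[ℝ] V).IsSymmetric := by
  intro u w
  have h := hf.isSymmSndFDerivAt (by simp) u w
  rw [ContinuousLinearMap.coe_coe, inner_hessianAt hf, real_inner_comm, inner_hessianAt hf, h]

omit [CompleteSpace V] in
/-- The left-most eigenvalue of a symmetric operator bounds its quadratic form from below. -/
lemma leftmostEigenvalue_mul_le [FiniteDimensional ℝ V] {A : V →L[ℝ] V}
    (hA : (A : V →ₗ[ℝ] V).IsSymmetric) (u : V) :
    leftmostEigenvalue A * ‖u‖ ^ 2 ≤ ⟪u, A u⟫_ℝ := by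
  rcases eq_or_ne u 0 with rfl | hu
  · simp
  have : Nontrivial V := ⟨u, 0, hu⟩
  have hfin : {μ : ℝ | Module.End.HasEigenvalue (A : Module.End ℝ V) μ}.Finite :=
    Module.End.finite_hasEigenvalue _
  have h1 : leftmostEigenvalue A ≤ _ :=
    csInf_le hfin.bddBelow hA.hasEigenvalue_iInf_of_finiteDimensional
  -- In nonzero finite dimension the infimum of the Rayleigh quotient is an eigenvalue. Boundedness
  -- is needed for this infimum to lie below the quotient at `u`.
  have hbdd : BddBelow (range fun x : {x : V // x ≠ 0} =>
      RCLike.re ⟪(A : V →ₗ[ℝ] V) x, (x : V)⟫_ℝ / ‖(x : V)‖ ^ 2) := by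
    refine ⟨-‖A‖, ?_⟩
    rintro _ ⟨x, rfl⟩
    have hx : 0 < ‖(x : V)‖ := norm_pos_iff.2 x.2
    simp only [le_div_iff₀ (pow_pos hx 2)]
    have := neg_abs_le ⟪(x : V), A x⟫_ℝ
    have h2 := abs_inner_apply_self_le le_rfl (A := A) (x : V)
    simp only [ContinuousLinearMap.coe_coe, RCLike.re_to_real, real_inner_comm]
    rw [real_inner_comm] at *
    linarith
  have h2 := h1.trans (ciInf_le hbdd ⟨u, hu⟩)
  rw [le_div_iff₀ (by positivity)] at h2
  simpa [real_inner_comm] using h2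

end SecondDerivative

/-! ### Smooth coordinates on the tangent bundle. -/

section Chart

variable {E : Type*} [NormedAddCommGroup E] [NormedSpace ℝ E]
  {H : Type*} [TopologicalSpace H] (I : ModelWithCorners ℝ E H) [I.Boundaryless]
  {M : Type*} [TopologicalSpace M] [ChartedSpace H M] [IsManifold I ∞ M]

/-- The parametrization of the tangent bundle near the fibre over `z` by the preferred chart. -/
noncomputable def tangentParam (z : M) (p : E × E) : TangentBundle I M :=
  ⟨(extChartAt I z).symm p.1,
    (trivializationAt E (TangentSpace I) z).symmL ℝ ((extChartAt I z).symm p.1) p.2⟩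

/-- A map into the bundle is smooth when its base point and its fibre coordinate are; near the given
point the fibre coordinate is just `p.2`. -/
lemma contMDiffAt_tangentParam (z : M) (w : E) :
    ContMDiffAt 𝓘(ℝ, E × E) I.tangent ∞ (tangentParam I z) (extChartAt I z z, w) := by
  have hz : (extChartAt I z).symm (extChartAt I z z) = z := extChartAt_to_inv z
  have hsymm : ContMDiffAt 𝓘(ℝ, E) I ∞ (extChartAt I z).symm (extChartAt I z z) :=
    (contMDiffOn_extChartAt_symm z).contMDiffAt (extChartAt_target_mem_nhds z)
  have hproj : ContMDiffAt 𝓘(ℝ, E × E) I ∞ (fun p : E × E => (extChartAt I z).symm p.1)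
      (extChartAt I z z, w) :=
    ContMDiffAt.comp (extChartAt I z z, w) hsymm contDiff_fst.contMDiff.contMDiffAt
  refine (Bundle.contMDiffAt_totalSpace (F := E) (E := TangentSpace I)).2 ⟨hproj, ?_⟩
  have hfst : (tangentParam I z (extChartAt I z z, w)).proj = z := hz
  rw [hfst]
  have hbase : ∀ᶠ p : E × E in 𝓝 (extChartAt I z z, w),
      (extChartAt I z).symm p.1 ∈ (trivializationAt E (TangentSpace I) z).baseSet := by
    refine hproj.continuousAt.eventually ?_
    simp only [hz]
    exact (trivializationAt E (TangentSpace I) z).open_baseSet.mem_nhds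
      (FiberBundle.mem_baseSet_trivializationAt' z)
  refine (contDiff_snd.contMDiff.contMDiffAt (x := (extChartAt I z z, w))).congr_of_eventuallyEq ?_
  filter_upwards [hbase] with p hp
  have h := (trivializationAt E (TangentSpace I) z).continuousLinearMapAt_symmL (R := ℝ) hp p.2
  rwa [Trivialization.continuousLinearMapAt_apply, Trivialization.coe_linearMapAt_of_mem _ hp] at h

omit [I.Boundaryless] in
lemma tangentParam_extChartAt {z y : M} (hy : y ∈ (extChartAt I z).source) (w : E) :
    tangentParam I z (extChartAt I z y, w) =
      ⟨y, (trivializationAt E (TangentSpace I) z).symmL ℝ y w⟩ := by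
  unfold tangentParam
  rw [(extChartAt I z).left_inv hy]

end Chart

/-! ### Regularity and gradient of the pullbacks. -/

section Pullback

variable {E : Type*} [NormedAddCommGroup E] [NormedSpace ℝ E] [FiniteDimensional ℝ E]
  {H : Type*} [TopologicalSpace H] {I : ModelWithCorners ℝ E H} [I.Boundaryless]
  {M : Type*} [TopologicalSpace M] [ChartedSpace H M] [IsManifold I ∞ M]
  [RiemannianBundle (fun x : M => TangentSpace I x)]
  {g : M → ℝ} {R : TangentBundle I M → M}

omit [FiniteDimensional ℝ E] [RiemannianBundle (fun x : M => TangentSpace I x)] in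
lemma contDiffAt_comp_tangentParam (hg : ContMDiff I 𝓘(ℝ, ℝ) 2 g) (hR : IsRetraction I R) (z : M)
    (w : E) :
    ContDiffAt ℝ 2 (fun p => g (R (tangentParam I z p))) (extChartAt I z z, w) := by
  rw [← contMDiffAt_iff_contDiffAt]
  have h1 := (hR.smooth.contMDiffAt (x := tangentParam I z (extChartAt I z z, w))).comp _
    (contMDiffAt_tangentParam I z w)
  exact (hg.contMDiffAt).comp _ (h1.of_le (WithTop.coe_le_coe.2 le_top))

omit [FiniteDimensional ℝ E] [I.Boundaryless]
  [RiemannianBundle (fun x : M => TangentSpace I x)] in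
lemma pullback_symmL {z y : M} (hy : y ∈ (extChartAt I z).source) (w : E) :
    pullback g R y ((trivializationAt E (TangentSpace I) z).symmL ℝ y w) =
      g (R (tangentParam I z (extChartAt I z y, w))) := by
  rw [tangentParam_extChartAt I hy]
  rfl

omit [FiniteDimensional ℝ E] [I.Boundaryless]
  [RiemannianBundle (fun x : M => TangentSpace I x)] in
lemma mk_eq_tangentParam (y : M) (w : TangentSpace I y) :
    (⟨y, w⟩ : TangentBundle I M) = tangentParam I y (extChartAt I y y,
      (trivializationAt E (TangentSpace I) y).continuousLinearMapAt ℝ y w) := by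
  rw [tangentParam_extChartAt I (mem_extChartAt_source y),
    Trivialization.symmL_continuousLinearMapAt _ (FiberBundle.mem_baseSet_trivializationAt' y)]

omit [FiniteDimensional ℝ E] in
lemma contDiffAt_pullback (hg : ContMDiff I 𝓘(ℝ, ℝ) 2 g) (hR : IsRetraction I R) (y : M)
    (w : TangentSpace I y) : ContDiffAt ℝ 2 (pullback g R y) w := by
  let A : TangentSpace I y →L[ℝ] E :=
    (trivializationAt E (TangentSpace I) y).continuousLinearMapAt ℝ y
  have h : pullback g R y = fun w => g (R (tangentParam I y (extChartAt I y y, A w))) := by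
    ext w
    rw [pullback, mk_eq_tangentParam y w]
  rw [h]
  exact ContDiffAt.comp w (g := fun p => g (R (tangentParam I y p)))
    (f := fun w => (extChartAt I y y, A w)) (contDiffAt_comp_tangentParam hg hR y (A w))
    (contDiffAt_const.prodMk A.contDiff.contDiffAt)

omit [FiniteDimensional ℝ E] [RiemannianBundle (fun x : M => TangentSpace I x)] in
/-- The curve traced by a retraction along a tangent vector is smooth. -/
lemma contMDiffAt_retraction_curve (hR : IsRetraction I R) (y : M) (u : TangentSpace I y) (t : ℝ) :
    ContMDiffAt 𝓘(ℝ, ℝ) I ∞ (fun t : ℝ => R ⟨y, t • u⟩) t := by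
  let v : E := (trivializationAt E (TangentSpace I) y).continuousLinearMapAt ℝ y u
  have h : (fun t : ℝ => R ⟨y, t • u⟩) =
      fun t : ℝ => R (tangentParam I y (extChartAt I y y, t • v)) := by
    ext t
    rw [mk_eq_tangentParam y (t • u), map_smul]
  rw [h]
  have h1 := (hR.smooth.contMDiffAt (x := tangentParam I y (extChartAt I y y, t • v))).comp _
    (contMDiffAt_tangentParam I y (t • v))
  have h2 : ContMDiffAt 𝓘(ℝ, ℝ) 𝓘(ℝ, E × E) ∞ (fun t : ℝ => (extChartAt I y y, t • v)) t :=
    (contDiff_const.prodMk (contDiff_id.smul contDiff_const)).contMDiff.contMDiffAt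
  exact ContMDiffAt.comp t (g := fun p => R (tangentParam I y p))
    (f := fun t : ℝ => (extChartAt I y y, t • v)) h1 h2

omit [FiniteDimensional ℝ E] [I.Boundaryless] [IsManifold I ∞ M]
  [RiemannianBundle (fun x : M => TangentSpace I x)] in
lemma deriv_comp_curve_eq_mvfderiv {c : ℝ → M} {t : ℝ} {y : M} {v : TangentSpace I y}
    (hg : MDifferentiableAt I 𝓘(ℝ, ℝ) g y) (hc : MDifferentiableAt 𝓘(ℝ, ℝ) I c t) (hy : c t = y)
    (hv : (mfderiv 𝓘(ℝ, ℝ) I c t (1 : ℝ) : E) = v) :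
    deriv (g ∘ c) t = mvfderiv I g y v := by
  subst hy
  have h := mfderiv_comp t hg hc
  rw [mfderiv_eq_fderiv] at h
  rw [← hv]
  exact congrArg (fun L => L (1 : ℝ)) h

omit [I.Boundaryless] [IsManifold I ∞ M] in
lemma inner_riemannianGradient (y : M) (u : TangentSpace I y) :
    ⟪riemannianGradient I g y, u⟫_ℝ = mvfderiv I g y u := by
  simp [riemannianGradient]

/-- Both sides, paired with `u`, give the derivative of `g` along the retraction curve, whose
initial velocity is `u`. -/
lemma gradient_pullback (hg : ContMDiff I 𝓘(ℝ, ℝ) 2 g) (hR : IsRetraction I R) (y : M) :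
    ∇ (pullback g R y) 0 = riemannianGradient I g y := by
  refine ext_inner_right ℝ fun u => ?_
  rw [inner_riemannianGradient]
  have hd : DifferentiableAt ℝ (pullback g R y) ((0 : ℝ) • u) :=
    (contDiffAt_pullback hg hR y _).differentiableAt (by simp)
  have hline : HasDerivAt (fun t : ℝ => t • u) u 0 := by
    simpa using (hasDerivAt_id (0 : ℝ)).smul_const u
  have h1 := (hd.hasFDerivAt.comp_hasDerivAt (0 : ℝ) hline).deriv
  have h2 := deriv_comp_curve_eq_mvfderiv (I := I) (g := g) (c := fun t : ℝ => R ⟨y, t • u⟩)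
    (t := 0) (hg.contMDiffAt.mdifferentiableAt (by simp))
    ((contMDiffAt_retraction_curve hR y u 0).mdifferentiableAt (by simp))
    (by simp [hR.map_zero]) (hR.velocity y u)
  rw [zero_smul] at h1
  rw [← InnerProductSpace.toDual_apply_apply (𝕜 := ℝ), toDual_gradient, ← h2]
  exact h1.symm

end Pullback

/-! ### Second-order criticality of accumulation points. -/

section Critical

variable {E : Type*} [NormedAddCommGroup E] [NormedSpace ℝ E] [FiniteDimensional ℝ E]
  {H : Type*} [TopologicalSpace H] {I : ModelWithCorners ℝ E H} [I.Boundaryless]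
  {M : Type*} [TopologicalSpace M] [ChartedSpace H M] [IsManifold I ∞ M]
  [RiemannianBundle (fun x : M => TangentSpace I x)]
  {g : M → ℝ} {R : TangentBundle I M → M}

/-- Second derivative along a line through the origin. -/
lemma deriv_deriv_line {W : Type*} [NormedAddCommGroup W] [NormedSpace ℝ W] {f : W → ℝ}
    {p u : W} (hf : ContDiffAt ℝ 2 f p) :
    deriv (fun t : ℝ => f (p + t • u)) 0 = fderiv ℝ f p u ∧
    deriv (deriv (fun t : ℝ => f (p + t • u))) 0 = fderiv ℝ (fderiv ℝ f) p u u := by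
  have hc : ContDiff ℝ 2 (fun t : ℝ => p + t • u) := by fun_prop
  have h1 : deriv (fun t : ℝ => p + t • u) = fun _ => u := by
    ext t
    simpa using (((hasDerivAt_id t).smul_const u).const_add p).deriv
  have h0 : p + (0 : ℝ) • u = p := by simp
  have hf' : ContDiffAt ℝ 2 f (p + (0 : ℝ) • u) := by rwa [h0]
  constructor
  · have h := fderiv_comp_deriv (l := f) (f := fun t : ℝ => p + t • u) (0 : ℝ)
      (hf'.differentiableAt (by simp)) (hc.differentiable (by simp) _)
    rw [h1, h0] at h
    exact h
  · have h := deriv_deriv_comp_curve (f := f) (c := fun t : ℝ => p + t • u) (t := 0)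
      hf' hc.contDiffAt
    rw [h1, h0, deriv_const, map_zero, add_zero] at h
    exact h

/-- The derivatives of the cost along retracted lines, in a chart. -/
lemma inner_symmL_eq_fderiv (hg : ContMDiff I 𝓘(ℝ, ℝ) 2 g) (hR : IsRetraction I R) {z y : M}
    (hy : y ∈ (extChartAt I z).source)
    (hF : ContDiffAt ℝ 2 (fun p => g (R (tangentParam I z p))) (extChartAt I z y, 0)) (v : E) :
    ⟪riemannianGradient I g y, (trivializationAt E (TangentSpace I) z).symmL ℝ y v⟫_ℝ =
      fderiv ℝ (fun p => g (R (tangentParam I z p))) (extChartAt I z y, 0) (0, v) ∧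
    ⟪(trivializationAt E (TangentSpace I) z).symmL ℝ y v,
      pullbackHessian g R y ((trivializationAt E (TangentSpace I) z).symmL ℝ y v)⟫_ℝ =
      fderiv ℝ (fderiv ℝ (fun p => g (R (tangentParam I z p)))) (extChartAt I z y, 0)
        (0, v) (0, v) := by
  set u := (trivializationAt E (TangentSpace I) z).symmL ℝ y v with hu
  have hP := contDiffAt_pullback hg hR y 0
  have hfun : (fun t : ℝ => pullback g R y (0 + t • u)) =
      fun t : ℝ => (fun p => g (R (tangentParam I z p))) ((extChartAt I z y, 0) + t • (0, v)) := by
    ext t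
    rw [zero_add, hu, ← map_smul, pullback_symmL hy]
    simp
  obtain ⟨h1, h2⟩ := deriv_deriv_line (u := u) hP
  obtain ⟨h3, h4⟩ := deriv_deriv_line (u := ((0 : E), v)) hF
  rw [hfun] at h1 h2
  rw [← h3, ← h4, h1, h2, ← gradient_pullback hg hR, pullbackHessian,
    real_inner_comm _ u, inner_hessianAt hP,
    ← InnerProductSpace.toDual_apply_apply (𝕜 := ℝ), toDual_gradient]
  exact ⟨rfl, rfl⟩

lemma lamNeg_mul_le (hg : ContMDiff I 𝓘(ℝ, ℝ) 2 g) (hR : IsRetraction I R) (y : M)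
    (u : TangentSpace I y) :
    -|lamNeg g R y| * ‖u‖ ^ 2 ≤ ⟪u, pullbackHessian g R y u⟫_ℝ := by
  have : FiniteDimensional ℝ (TangentSpace I y) := inferInstanceAs (FiniteDimensional ℝ E)
  have h := leftmostEigenvalue_mul_le
    (hessianAt_isSymmetric (contDiffAt_pullback hg hR y 0)) u
  refine le_trans ?_ h
  gcongr
  rw [lamNeg, abs_of_nonpos (min_le_right _ _), neg_neg]
  exact min_le_left _ _

/-- If the gradient norm and the negative curvature tend to zero along a sequence, its
accumulation points have zero gradient and positive semidefinite pullback Hessian. -/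
lemma criticality_of_mapClusterPt [IsContMDiffRiemannianBundle I ∞ E (fun x : M => TangentSpace I x)]
    (hg : ContMDiff I 𝓘(ℝ, ℝ) 2 g) (hR : IsRetraction I R) {y : ℕ → M} {z : M}
    (hz : MapClusterPt z atTop y)
    (h1 : Tendsto (fun k => ‖riemannianGradient I g (y k)‖) atTop (𝓝 0))
    (h2 : Tendsto (fun k => |lamNeg g R (y k)|) atTop (𝓝 0)) (u : TangentSpace I z) :
    ⟪riemannianGradient I g z, u⟫_ℝ = 0 ∧ 0 ≤ ⟪u, pullbackHessian g R z u⟫_ℝ := by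
  have : IsContinuousRiemannianBundle E (fun x : M => TangentSpace I x) := by
    obtain ⟨G, hG, hG'⟩ := IsContMDiffRiemannianBundle.exists_contMDiff (IB := I) (n := ∞)
      (F := E) (E := fun x : M => TangentSpace I x)
    exact ⟨G, hG.continuous, hG'⟩
  -- An ultrafilter finer than `atTop` turns the cluster point into a genuine limit, in place of a
  -- subsequence.
  obtain ⟨U, hU, hUz⟩ := mapClusterPt_iff_ultrafilter.1 hz
  replace h1 := h1.mono_left hU
  replace h2 := h2.mono_left hU
  -- Continuity of the metric bounds the trivialization inverses near `z`, so a fixed `v` yields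
  -- tangent vectors at `y k` of norm at most `C * ‖v‖`.
  obtain ⟨C, hC, hCev⟩ :=
    eventually_norm_symmL_trivializationAt_lt E (fun x : M => TangentSpace I x) z
  set v : E := (trivializationAt E (TangentSpace I) z).continuousLinearMapAt ℝ z u with hv
  have hu : (trivializationAt E (TangentSpace I) z).symmL ℝ z v = u :=
    Trivialization.symmL_continuousLinearMapAt _ (FiberBundle.mem_baseSet_trivializationAt' z) u
  set F : E × E → ℝ := fun p => g (R (tangentParam I z p)) with hFdef
  have hF : ContDiffAt ℝ 2 F (extChartAt I z z, 0) := contDiffAt_comp_tangentParam hg hR z 0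
  have hlim : Tendsto (fun k => (extChartAt I z (y k), (0 : E))) U
      (𝓝 (extChartAt I z z, 0)) :=
    (((continuousAt_extChartAt z).tendsto.comp hUz).prodMk_nhds tendsto_const_nhds)
  have hsrc : ∀ᶠ k in (U : Filter ℕ), y k ∈ (extChartAt I z).source :=
    hUz.eventually (extChartAt_source_mem_nhds z)
  have hFev := hlim.eventually (hF.eventually (by simp))
  have hD1 : ContDiffAt ℝ 1 (fderiv ℝ F) (extChartAt I z z, 0) := hF.fderiv_right (by norm_num)
  have hD2 : ContDiffAt ℝ 0 (fderiv ℝ (fderiv ℝ F)) (extChartAt I z z, 0) :=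
    hD1.fderiv_right (by norm_num)
  have hl1 : Tendsto (fun k => fderiv ℝ F (extChartAt I z (y k), 0) (0, v)) U
      (𝓝 (fderiv ℝ F (extChartAt I z z, 0) (0, v))) :=
    (ContinuousAt.clm_apply hD1.continuousAt continuousAt_const).tendsto.comp hlim
  have hl2 : Tendsto (fun k => fderiv ℝ (fderiv ℝ F) (extChartAt I z (y k), 0) (0, v) (0, v)) U
      (𝓝 (fderiv ℝ (fderiv ℝ F) (extChartAt I z z, 0) (0, v) (0, v))) :=
    (ContinuousAt.clm_apply (ContinuousAt.clm_apply hD2.continuousAt continuousAt_const)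
      continuousAt_const).tendsto.comp hlim
  obtain ⟨e1, e2⟩ := inner_symmL_eq_fderiv hg hR (mem_extChartAt_source z) hF v
  rw [hu] at e1 e2
  have hnorm : ∀ᶠ k in (U : Filter ℕ),
      ‖(trivializationAt E (TangentSpace I) z).symmL ℝ (y k) v‖ ≤ C * ‖v‖ :=
    (hUz.eventually hCev).mono fun k hk => ContinuousLinearMap.le_of_opNorm_le _ hk.le v
  rw [e1, e2]
  constructor
  · refine tendsto_nhds_unique hl1 (squeeze_zero_norm' ?_
      (by simpa using h1.mul_const (C * ‖v‖)))
    filter_upwards [hsrc, hFev, hnorm] with k hk hFk hn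
    rw [← (inner_symmL_eq_fderiv hg hR hk hFk v).1]
    exact (norm_inner_le_norm _ _).trans (by gcongr)
  · have hb : Tendsto (fun k => -|lamNeg g R (y k)| * (C * ‖v‖) ^ 2) U (𝓝 0) := by
      simpa using h2.neg.mul_const ((C * ‖v‖) ^ 2)
    refine le_of_tendsto_of_tendsto hb hl2 ?_
    filter_upwards [hsrc, hFev, hnorm] with k hk hFk hn
    rw [← (inner_symmL_eq_fderiv hg hR hk hFk v).2]
    refine le_trans ?_ (lamNeg_mul_le hg hR (y k) _)
    rw [neg_mul, neg_mul, neg_le_neg_iff]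
    gcongr

omit [FiniteDimensional ℝ E] [RiemannianBundle (fun x : M => TangentSpace I x)] in
/-- At a point where the differential of `g` vanishes, the second derivative of `g` along a curve
depends only on the velocity of the curve. -/
lemma deriv_deriv_comp_curve_congr {z : M} (hg : ContMDiffAt I 𝓘(ℝ, ℝ) 2 g z)
    (hdg : mvfderiv I g z = 0) {c₁ c₂ : ℝ → M} (h₁ : ContMDiffAt 𝓘(ℝ, ℝ) I 2 c₁ 0)
    (h₂ : ContMDiffAt 𝓘(ℝ, ℝ) I 2 c₂ 0) (hz₁ : c₁ 0 = z) (hz₂ : c₂ 0 = z)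
    (hv : (mfderiv 𝓘(ℝ, ℝ) I c₁ 0 (1 : ℝ) : E) = mfderiv 𝓘(ℝ, ℝ) I c₂ 0 (1 : ℝ)) :
    deriv (deriv (g ∘ c₁)) 0 = deriv (deriv (g ∘ c₂)) 0 := by
  set f : E → ℝ := g ∘ (extChartAt I z).symm with hf
  have hsymm : ContMDiffAt 𝓘(ℝ, E) I 2 (extChartAt I z).symm (extChartAt I z z) :=
    (contMDiffOn_extChartAt_symm z).contMDiffAt (extChartAt_target_mem_nhds z)
  have hinv : (extChartAt I z).symm (extChartAt I z z) = z := extChartAt_to_inv z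
  have hg' : ContMDiffAt I 𝓘(ℝ, ℝ) 2 g ((extChartAt I z).symm (extChartAt I z z)) := by
    rwa [hinv]
  have hfC : ContDiffAt ℝ 2 f (extChartAt I z z) :=
    (hg'.comp _ hsymm).contDiffAt
  have hmg : mfderiv I 𝓘(ℝ, ℝ) g z = 0 := by
    ext w
    exact congrArg (fun L => L w) hdg
  have hf0 : fderiv ℝ f (extChartAt I z z) = 0 := by
    have h := mfderiv_comp (extChartAt I z z) (hg'.mdifferentiableAt (by simp))
      (hsymm.mdifferentiableAt (by simp))
    rw [mfderiv_eq_fderiv] at h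
    -- The base point is generalized because its tangent space appears in the type of the
    -- differential.
    have h0 : ∀ x, x = z → mfderiv I 𝓘(ℝ, ℝ) g x = 0 := by
      rintro x rfl
      exact hmg
    rw [h0 _ hinv] at h
    exact h.trans (by ext; rfl)
  have key : ∀ c : ℝ → M, ContMDiffAt 𝓘(ℝ, ℝ) I 2 c 0 → c 0 = z →
      deriv (extChartAt I z ∘ c) 0 =
        mfderiv I 𝓘(ℝ, E) (extChartAt I z) z (mfderiv 𝓘(ℝ, ℝ) I c 0 (1 : ℝ) : E) ∧
      deriv (deriv (g ∘ c)) 0 = fderiv ℝ (fderiv ℝ f) (extChartAt I z z)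
        (deriv (extChartAt I z ∘ c) 0) (deriv (extChartAt I z ∘ c) 0) := by
    intro c hc hcz
    have hφ : ContMDiffAt I 𝓘(ℝ, E) 2 (extChartAt I z) (c 0) := by
      rw [hcz]
      exact contMDiffAt_extChartAt
    constructor
    · have h := mfderiv_comp (0 : ℝ) (hφ.mdifferentiableAt (by simp))
        (hc.mdifferentiableAt (by simp))
      rw [mfderiv_eq_fderiv] at h
      subst hcz
      exact congrArg (fun L => L (1 : ℝ)) h
    · have hcC : ContDiffAt ℝ 2 (extChartAt I z ∘ c) 0 := (hφ.comp _ hc).contDiffAt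
      have hev : g ∘ c =ᶠ[𝓝 0] f ∘ (extChartAt I z ∘ c) := by
        have hsrc : ∀ᶠ t in 𝓝 (0 : ℝ), c t ∈ (extChartAt I z).source :=
          hc.continuousAt.eventually (by rw [hcz]; exact extChartAt_source_mem_nhds z)
        filter_upwards [hsrc] with t ht
        rw [hf, Function.comp_apply, Function.comp_apply, Function.comp_apply,
          Function.comp_apply, (extChartAt I z).left_inv ht]
      have hcz' : (extChartAt I z ∘ c) 0 = extChartAt I z z := congrArg _ hcz
      -- The acceleration of the curve enters only through the first derivative of `f`, which
      -- vanishes here.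
      rw [hev.deriv.deriv_eq, deriv_deriv_comp_curve (by rwa [hcz']) hcC, hcz', hf0,
        zero_apply, add_zero]
  rw [(key c₁ h₁ hz₁).2, (key c₂ h₂ hz₂).2, (key c₁ h₁ hz₁).1, (key c₂ h₂ hz₂).1, hv]

lemma isTwoCritical_of_pullback (hg : ContMDiff I 𝓘(ℝ, ℝ) 2 g) (hR : IsRetraction I R) {z : M}
    (h1 : ∀ u : TangentSpace I z, ⟪riemannianGradient I g z, u⟫_ℝ = 0)
    (h2 : ∀ u : TangentSpace I z, 0 ≤ ⟪u, pullbackHessian g R z u⟫_ℝ) : IsTwoCritical I g z := by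
  intro c hc hcz
  have hdg : mvfderiv I g z = 0 := by
    ext u
    rw [← inner_riemannianGradient, h1]
    rfl
  -- The retraction curve with this velocity replaces `c`; along it the second derivative is the
  -- Hessian form of the pullback.
  let u : TangentSpace I z := (mfderiv 𝓘(ℝ, ℝ) I c 0 (1 : ℝ) : E)
  refine ⟨?_, ?_⟩
  · rw [deriv_comp_curve_eq_mvfderiv (v := u) (hg.contMDiffAt.mdifferentiableAt (by simp))
      (hc.contMDiffAt.mdifferentiableAt (by simp)) hcz rfl, hdg]
    rfl
  · have hle : (2 : ℕ∞ω) ≤ ((⊤ : ℕ∞) : ℕ∞ω) := WithTop.coe_le_coe.2 le_top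
    rw [deriv_deriv_comp_curve_congr hg.contMDiffAt hdg (hc.contMDiffAt.of_le hle)
      ((contMDiffAt_retraction_curve hR z u 0).of_le hle) hcz (by simp [hR.map_zero])
      (hR.velocity z u).symm]
    have h := (deriv_deriv_line (u := u) (contDiffAt_pullback hg hR z 0)).2
    simp only [zero_add] at h
    rw [← inner_hessianAt (contDiffAt_pullback hg hR z 0), real_inner_comm] at h
    exact (h2 u).trans h.ge

end Critical

theorem mainTheorem4
    {E : Type*} [NormedAddCommGroup E] [NormedSpace ℝ E] [FiniteDimensional ℝ E]
    {H : Type*} [TopologicalSpace H] {I : ModelWithCorners ℝ E H} [I.Boundaryless]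
    {M : Type*} [TopologicalSpace M] [T2Space M] [SecondCountableTopology M]
    [ChartedSpace H M] [IsManifold I ∞ M]
    [RiemannianBundle (fun x : M => TangentSpace I x)]
    [IsContMDiffRiemannianBundle I ∞ E (fun x : M => TangentSpace I x)]
    (g : M → ℝ) (hg : ContMDiff I 𝓘(ℝ, ℝ) 2 g)
    (R : TangentBundle I M → M) (hR : IsRetraction I R)
    (Φ : M → M) (hΦ : ∀ y, g (Φ y) ≤ g y)
    (γc η γlo γhi : ℝ) (hγc : γc ∈ Ioo (0 : ℝ) 1) (hη : η ∈ Ioo (0 : ℝ) 1)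
    (hγlo : 0 < γlo) (hγ : γlo ≤ γhi)
    (yin : M) (y : ℕ → M) (γ : ℕ → ℝ) (s : ∀ k, TangentSpace I (y k))
    (hrun : IsHookedTrustRegionRun g R Φ γc η γlo γhi yin y γ s)
    (L₁ L₂ : ℝ) (hL₁ : 0 ≤ L₁) (hL₂ : 0 ≤ L₂)
    (hLip : PullbackLipschitz g R L₁ L₂ y s)
    (gmin : ℝ) (hgmin : ∀ k, gmin ≤ g (y k)) :
    gammaMin γc η γlo L₁ L₂ ∈ Ioo (0 : ℝ) 1 ∧
    (∀ ε₁ ε₂ : ℝ, 0 < ε₁ → 0 < ε₂ →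
      {k : ℕ | ε₁ < ‖riemannianGradient I g (y k)‖ ∨ ε₂ < |lamNeg g R (y k)|}.Finite ∧
      ({k : ℕ | ε₁ < ‖riemannianGradient I g (y k)‖ ∨ ε₂ < |lamNeg g R (y k)|}.ncard : ℤ) ≤
        ⌈Real.logb γc (gammaMin γc η γlo L₁ L₂ / γhi) + 1⌉ *
          ⌊(g (y 0) - gmin) / kappaMin γc η γlo L₁ L₂ * max (1 / ε₁ ^ 2) (1 / ε₂ ^ 3)⌋) ∧
    (∀ z : M, MapClusterPt z atTop y → IsTwoCritical I g z) := by
  have hgrad : ∀ z : M, ∇ (pullback g R z) 0 = riemannianGradient I g z := gradient_pullback hg hR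
  have hfin := fun ε₁ ε₂ hε₁ hε₂ =>
    iteration_complexity hgrad hR.map_zero hΦ hγc hη hγlo hrun hL₁ hL₂ hLip hgmin
      (ε₁ := ε₁) (ε₂ := ε₂) hε₁ hε₂
  refine ⟨⟨gammaMin_pos hγc.1 hη.2 hγlo, gammaMin_lt_one hγc hL₁⟩, hfin, fun z hz => ?_⟩
  have hsmall : ∀ ε : ℝ, 0 < ε → ∀ᶠ k in atTop,
      ‖riemannianGradient I g (y k)‖ ≤ ε ∧ |lamNeg g R (y k)| ≤ ε := by
    intro ε hε
    -- A finite exceptional set of indices is eventually avoided.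
    have h := (hfin ε ε hε hε).1.compl_mem_cofinite
    rw [Nat.cofinite_eq_atTop] at h
    filter_upwards [h] with k hk
    exact ⟨not_lt.1 fun h' => hk (Or.inl h'), not_lt.1 fun h' => hk (Or.inr h')⟩
  have hlim : ∀ a : ℕ → ℝ, (∀ k, 0 ≤ a k) → (∀ ε : ℝ, 0 < ε → ∀ᶠ k in atTop, a k ≤ ε) →
      Tendsto a atTop (𝓝 0) := fun a ha h =>
    tendsto_order.2 ⟨fun b hb => Eventually.of_forall fun k => hb.trans_le (ha k), fun b hb =>
      (h (b / 2) (half_pos hb)).mono fun k hk => hk.trans_lt (half_lt_self hb)⟩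
  have hcrit := criticality_of_mapClusterPt hg hR hz
    (hlim _ (fun _ => norm_nonneg _) fun ε hε => (hsmall ε hε).mono fun _ h => h.1)
    (hlim _ (fun _ => abs_nonneg _) fun ε hε => (hsmall ε hε).mono fun _ h => h.2)
  exact isTwoCritical_of_pullback hg hR (fun u => (hcrit u).1) fun u => (hcrit u).2
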